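/- Call a polynomial in $\mathbb{R}[t]$ real-rooted if it is the zero polynomial or all of its complex roots are real (so constants are real-rooted). Call $(f_1,f_2,f_3)$ compatible if $\alpha_1 f_1+\alpha_2 f_2+\alpha_3 f_3$ is real-rooted for all $\alpha_1,\alpha_2,\alpha_3 \ge 0$. For a real-rooted $f \not\equiv 0$ let $\lambda_1(f)\ge\lambda_2(f)\ge\cdots$ be its roots, counted with multiplicity. For real-rooted $f,g$ with positive leading coefficients write $f \ll g$ if $\deg f \in \{\deg g,\deg g-1\}$ and $$\lambda_1(g)\ge\lambda_1(f)\ge\lambda_2(g)\ge\lambda_2(f)\ge\lambda_3(g)\ge\cdots.$$ Extend the relation $\ll$ to all real-rooted polynomials by the rule that $f \ll g$ implies $g \ll -f$, and by the convention that $0 \ll f$ and $f \ll 0$ for every real-rooted $f$. **Proposition 1.3.** Let $f_1,f_2,f_3\in\mathbb{R}[t]$ be real-rooted. Then $(f_1,f_2,f_3)$ is compatible if and only if at least one of the following conditions holds: 1. there is a real-rooted $g\in\mathbb{R}[t]$, $g \not\equiv 0$, such that $f_1 \ll g$, $f_2 \ll g$ and $f_3 \ll g$; 2. there are a choice of $\{i,j,k\}=\{1,2,3\}$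 and real numbers $a\ge 0$ and $b,c>0$ such that $a f_i+b f_j+c f_k\equiv 0$ and either $f_i \ll f_j$ or $f_j \ll f_i$. -/

import Mathlib

open Polynomial

/-- A real polynomial is real-rooted if it factors over `ℝ` as a constant times a product of
linear factors, i.e. if all of its complex roots are real. Constants, and in particular the zero
polynomial, are real-rooted. -/
def RealRooted (f : ℝ[X]) : Prop := f.Splits

/-- A finite family of real polynomials is compatible if every non-negative linear combination
of it is real-rooted. -/
def Compatible {n : ℕ} (f : Fin n → ℝ[X]) : Prop :=
  ∀ c : Fin n → ℝ, (∀ i, 0 ≤ c i) → RealRooted (∑ i, c i • f i)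

/-- The real roots of `f`, with multiplicity, in weakly decreasing order
`λ₁(f) ≥ λ₂(f) ≥ ⋯` (the entry with index `i` is `λ_{i+1}(f)`). -/
noncomputable def rootList (f : ℝ[X]) : List ℝ := f.roots.sort (· ≥ ·)

/-- All the inequalities of `λ₁(g) ≥ λ₁(f) ≥ λ₂(g) ≥ λ₂(f) ≥ λ₃(g) ≥ ⋯`, as far as
the roots exist. -/
def RootsAlternate (f g : ℝ[X]) : Prop :=
  (∀ (i : ℕ) (hf : i < (rootList f).length) (hg : i < (rootList g).length),
    (rootList f)[i] ≤ (rootList g)[i]) ∧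
  (∀ (i : ℕ) (hf : i < (rootList f).length) (hg : i + 1 < (rootList g).length),
    (rootList g)[i + 1] ≤ (rootList f)[i])

/-- The relation `f ≪ g` ("`g` interlaces `f`"). For real-rooted polynomials with positive
leading coefficients it says that `deg f ∈ {deg g, deg g - 1}` and that the roots alternate,
starting with the largest root of `g`. It is extended to other signs by the rule that `f ≪ g`
implies `g ≪ -f`, and to the zero polynomial by `0 ≪ f` and `f ≪ 0` for real-rooted `f`. -/
inductive InterlacedBy : ℝ[X] → ℝ[X] → Prop
  | of_pos (f g : ℝ[X]) (hf : RealRooted f) (hg : RealRooted g)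
      (hf_pos : 0 < f.leadingCoeff) (hg_pos : 0 < g.leadingCoeff)
      (hdeg : f.natDegree = g.natDegree ∨ f.natDegree + 1 = g.natDegree)
      (halt : RootsAlternate f g) : InterlacedBy f g
  | rotate (f g : ℝ[X]) (h : InterlacedBy f g) : InterlacedBy g (-f)
  | zero_left (f : ℝ[X]) (hf : RealRooted f) : InterlacedBy 0 f
  | zero_right (f : ℝ[X]) (hf : RealRooted f) : InterlacedBy f 0

/-! A real-rooted `f ≠ 0` has no zeros in the upper half-plane, so its argument has a continuous
branch there, `phase f`. At a real non-root `t` this branch tends to `π` times the number of roots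
above `t`, plus `π` if the leading coefficient is negative. For linearly independent `f`, `g`, the
relation `f ≪ g` forces `Im (f(z) * conj (g(z))) < 0` on the upper half-plane
(`InterlacedBy.dependent_or_im_neg`). Conversely, bounds on phase differences pass to the real line
and bound differences of root counts, and these encode interlacing (`interlacedBy_of_countAbove`).

Sufficiency: if every `f i ≪ g`, a non-negative combination either is a multiple of `g` or satisfies
the same strict inequality, so it has no zero with positive imaginary part. In the second case every
combination reduces to two interlacing polynomials, and the inequality makes all their real
combinations real-rooted.

Necessity: a non-trivial positive relation lets non-negative combinations reach, up to sign, every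
real combination of two members. Their phase difference then avoids multiples of `π` (unless they
are dependent), stays in one gap by connectedness, and yields interlacing. Without such a relation,
`0` is not a non-trivial non-negative combination of the values at `z` of the non-zero members. So
their phases, shifted by constant multiples of `2π`, differ by at most `π`, and the shifted root
counts differ by at most `1`. The pointwise maximum of these counts is, up to a constant, again a
root count, and it defines the common interlacer `g` (`NoPositiveRelation.exists_interlacedBy`). -/

/-! ### Counting functions of finite multisets of reals -/

/-- The number of elements of `s` larger than `t`. -/
noncomputable def countAbove (s : Multiset ℝ) (t : ℝ) : ℕ := s.countP (fun a => t < a)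

/-- In a decreasing list the entries above `t` form an initial segment. This translates between
sorted roots and counting functions. -/
theorem lt_countP_iff {L : List ℝ} (hL : L.Pairwise (· ≥ ·)) (t : ℝ) (i : ℕ) :
    i < L.countP (fun a => t < a) ↔ ∃ h : i < L.length, t < L[i] := by
  induction L generalizing i with
  | nil => simp
  | cons a L ih =>
    rw [List.pairwise_cons] at hL
    by_cases hta : t < a
    · cases i with
      | zero => simp [hta]
      | succ i => simp [hta, ih hL.2]
    · have h0 : L.countP (fun a => t < a) = 0 := by
        rw [List.countP_eq_zero]
        intro b hb
        have := hL.1 b hb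
        simp only [decide_eq_true_eq]
        linarith
      have hmem : ∀ b ∈ a :: L, b ≤ a := by
        intro b hb
        rcases List.mem_cons.1 hb with h | h
        · exact h.le
        · exact hL.1 b h
      constructor
      · intro h
        rw [List.countP_cons, h0] at h
        simp [hta] at h
      · rintro ⟨h, h'⟩
        exact absurd (h'.trans_le (hmem _ (List.getElem_mem h))) hta

theorem countAbove_sort (s : Multiset ℝ) (t : ℝ) :
    (s.sort (· ≥ ·)).countP (fun a => t < a) = countAbove s t := by
  rw [countAbove, ← Multiset.coe_countP, Multiset.sort_eq]

theorem exists_forall_lt (s : Multiset ℝ) : ∃ t, ∀ a ∈ s, t < a := by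
  obtain ⟨t, ht⟩ := s.toFinset.bddBelow
  exact ⟨t - 1, fun a ha => by linarith [ht (Multiset.mem_toFinset.2 ha)]⟩

theorem exists_forall_gt (s : Multiset ℝ) : ∃ t, ∀ a ∈ s, a < t := by
  obtain ⟨t, ht⟩ := s.toFinset.bddAbove
  exact ⟨t + 1, fun a ha => by linarith [ht (Multiset.mem_toFinset.2 ha)]⟩

theorem countAbove_eq_card {s : Multiset ℝ} {t : ℝ} (h : ∀ a ∈ s, t < a) :
    countAbove s t = s.card :=
  Multiset.countP_eq_card.2 h

theorem countAbove_eq_zero {s : Multiset ℝ} {t : ℝ} (h : ∀ a ∈ s, a < t) :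
    countAbove s t = 0 :=
  Multiset.countP_eq_zero.2 fun a ha => (h a ha).le.not_gt

/-- `t` can be moved to the right, off all elements of `s`, without passing an element. -/
theorem exists_gt_countAbove_eq (s : Multiset ℝ) (t : ℝ) :
    ∃ u, u ∉ s ∧ ∀ r ≤ s, countAbove r u = countAbove r t := by
  obtain ⟨u, htu, hu⟩ : ∃ u > t, ∀ a ∈ s, t < a → u < a := by
    induction s using Multiset.induction with
    | empty => exact ⟨t + 1, by simp⟩
    | cons a s ih =>
      obtain ⟨u, htu, hu⟩ := ih
      by_cases hta : t < a
      · refine ⟨min u ((t + a) / 2), lt_min htu (by linarith), fun b hb htb => ?_⟩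
        rcases Multiset.mem_cons.1 hb with rfl | hb
        · exact (min_le_right _ _).trans_lt (by linarith)
        · exact (min_le_left _ _).trans_lt (hu b hb htb)
      · refine ⟨u, htu, fun b hb htb => ?_⟩
        rcases Multiset.mem_cons.1 hb with rfl | hb
        · exact absurd htb hta
        · exact hu b hb htb
  refine ⟨u, fun h => lt_irrefl _ (hu u h htu), fun r hr => ?_⟩
  refine Multiset.countP_congr rfl fun a ha => propext ⟨fun h => htu.lt.trans h, hu a ?_⟩
  exact Multiset.mem_of_le hr ha

/-- The witness is the entrywise maximum of the two sorted lists, followed by the rest of the longer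
one. -/
theorem exists_countAbove_sup_list (A B : List ℝ) (hA : A.Pairwise (· ≥ ·))
    (hB : B.Pairwise (· ≥ ·)) :
    ∃ C : Multiset ℝ, ∀ t, countAbove C t = max (countAbove A t) (countAbove B t) := by
  induction A generalizing B with
  | nil => exact ⟨B, fun t => by simp [countAbove]⟩
  | cons a A ih =>
    cases B with
    | nil => exact ⟨(a :: A : List ℝ), fun t => by simp [countAbove]⟩
    | cons b B =>
      rw [List.pairwise_cons] at hA hB
      obtain ⟨C, hC⟩ := ih B hA.2 hB.2
      refine ⟨max a b ::ₘ C, fun t => ?_⟩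
      have hC := hC t
      have h0 : ∀ (x : ℝ) (L : List ℝ), (∀ y ∈ L, x ≥ y) → ¬ t < x → countAbove L t = 0 := by
        intro x L hL hx
        refine Multiset.countP_eq_zero.2 fun y hy hty => hx (hty.trans_le (hL y (by simpa using hy)))
      have hA0 := h0 a A hA.1
      have hB0 := h0 b B hB.1
      rw [← Multiset.cons_coe, ← Multiset.cons_coe]
      simp only [countAbove, Multiset.countP_cons, lt_max_iff] at *
      by_cases h1 : t < a <;> by_cases h2 : t < b <;> simp only [h1, h2, or_true, true_or, or_self,
        if_true, if_false, not_true_eq_false, not_false_eq_true, forall_const, false_imp_iff] at * <;>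
        omega

theorem exists_countAbove_sup (A B : Multiset ℝ) :
    ∃ C : Multiset ℝ, ∀ t, countAbove C t = max (countAbove A t) (countAbove B t) := by
  simpa using exists_countAbove_sup_list _ _ (A.pairwise_sort (· ≥ ·)) (B.pairwise_sort (· ≥ ·))

/-- Dropping the largest element lowers the count by one wherever it is positive, which matches
truncated subtraction. -/
theorem exists_countAbove_sub_one (A : Multiset ℝ) :
    ∃ C : Multiset ℝ, ∀ t, countAbove C t = countAbove A t - 1 := by
  have hA := A.pairwise_sort (· ≥ ·)
  rw [← A.sort_eq (· ≥ ·)]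
  generalize A.sort (· ≥ ·) = L at hA
  cases L with
  | nil => exact ⟨0, fun t => by simp [countAbove]⟩
  | cons a L =>
    refine ⟨L, fun t => ?_⟩
    rw [← Multiset.cons_coe, countAbove, countAbove, Multiset.countP_cons]
    split_ifs with h
    · omega
    · have : Multiset.countP (fun a => t < a) (L : Multiset ℝ) = 0 :=
        Multiset.countP_eq_zero.2 fun y hy hty =>
          h (hty.trans_le ((List.pairwise_cons.1 hA).1 y (by simpa using hy)))
      omega

theorem exists_countAbove_sub (A : Multiset ℝ) (d : ℕ) :
    ∃ C : Multiset ℝ, ∀ t, countAbove C t = countAbove A t - d := by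
  induction d with
  | zero => exact ⟨A, fun t => rfl⟩
  | succ d ih =>
    obtain ⟨C, hC⟩ := ih
    obtain ⟨D, hD⟩ := exists_countAbove_sub_one C
    exact ⟨D, fun t => by rw [hD, hC]; omega⟩

theorem exists_countAbove_finset_sup {ι : Type*} (s : Finset ι) (A : ι → Multiset ℝ) (d : ι → ℕ) :
    ∃ C : Multiset ℝ, ∀ t, countAbove C t = s.sup fun i => countAbove (A i) t - d i := by
  classical
  induction s using Finset.induction with
  | empty => exact ⟨0, fun t => by simp [countAbove]⟩
  | insert i s _ ih =>
    obtain ⟨C, hC⟩ := ih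
    obtain ⟨D, hD⟩ := exists_countAbove_sub (A i) (d i)
    obtain ⟨E, hE⟩ := exists_countAbove_sup D C
    exact ⟨E, fun t => by rw [hE, hC, hD, Finset.sup_insert]⟩

/-! ### Interlacing in terms of root counts -/

theorem rootsAlternate_of_countAbove {f g : ℝ[X]}
    (h₁ : ∀ t, countAbove f.roots t ≤ countAbove g.roots t)
    (h₂ : ∀ t, countAbove g.roots t ≤ countAbove f.roots t + 1) : RootsAlternate f g := by
  have key : ∀ (p : ℝ[X]) (t : ℝ) (i : ℕ), i < countAbove p.roots t ↔
      ∃ h : i < (rootList p).length, t < (rootList p)[i] := fun p t i => by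
    rw [← countAbove_sort]
    exact lt_countP_iff (p.roots.pairwise_sort (· ≥ ·)) t i
  constructor
  · intro i hf hg
    by_contra! h
    have := ((key f _ i).2 ⟨hf, h⟩).trans_le (h₁ _)
    exact lt_irrefl _ ((key g _ i).1 this).2
  · intro i hf hg
    by_contra! h
    have : i + 1 < countAbove f.roots (rootList f)[i] + 1 :=
      ((key g _ (i + 1)).2 ⟨hg, h⟩).trans_le (h₂ _)
    exact lt_irrefl _ ((key f _ i).1 (Nat.succ_lt_succ_iff.1 this)).2

theorem interlacedBy_of_countAbove_of_pos {f g : ℝ[X]} (hf : f.Splits) (hg : g.Splits)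
    (hf0 : 0 < f.leadingCoeff) (hg0 : 0 < g.leadingCoeff)
    (h₁ : ∀ t, countAbove f.roots t ≤ countAbove g.roots t)
    (h₂ : ∀ t, countAbove g.roots t ≤ countAbove f.roots t + 1) : InterlacedBy f g := by
  refine .of_pos f g hf hg hf0 hg0 ?_ (rootsAlternate_of_countAbove h₁ h₂)
  -- To the left of all roots the counts are the degrees.
  obtain ⟨t, ht⟩ := exists_forall_lt (f.roots + g.roots)
  have h₁ := h₁ t
  have h₂ := h₂ t
  rw [countAbove_eq_card fun a ha => ht a (Multiset.mem_add.2 (.inl ha)),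
    countAbove_eq_card fun a ha => ht a (Multiset.mem_add.2 (.inr ha)),
    ← hf.natDegree_eq_card_roots, ← hg.natDegree_eq_card_roots] at h₁ h₂
  omega

theorem InterlacedBy.neg_neg {f g : ℝ[X]} (h : InterlacedBy f g) : InterlacedBy (-f) (-g) :=
  (h.rotate).rotate

theorem interlacedBy_of_countAbove {f g : ℝ[X]} (hf : f.Splits) (hg : g.Splits)
    (h0 : 0 < f.leadingCoeff * g.leadingCoeff)
    (h₁ : ∀ t, countAbove f.roots t ≤ countAbove g.roots t)
    (h₂ : ∀ t, countAbove g.roots t ≤ countAbove f.roots t + 1) : InterlacedBy f g := by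
  rcases pos_and_pos_or_neg_and_neg_of_mul_pos h0 with ⟨hf0, hg0⟩ | ⟨hf0, hg0⟩
  · exact interlacedBy_of_countAbove_of_pos hf hg hf0 hg0 h₁ h₂
  · have := interlacedBy_of_countAbove_of_pos (f := -f) (g := -g) hf.neg hg.neg (by simpa) (by simpa)
      (by simpa using h₁) (by simpa using h₂)
    simpa using this.neg_neg

/-- With opposite leading signs the roles swap: `g ≪ -f` comes from the counts, and rotating and
changing both signs gives `f ≪ g`. -/
theorem interlacedBy_of_countAbove_of_neg {f g : ℝ[X]} (hf : f.Splits) (hg : g.Splits)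
    (h0 : f.leadingCoeff * g.leadingCoeff < 0)
    (h₁ : ∀ t, countAbove g.roots t ≤ countAbove f.roots t)
    (h₂ : ∀ t, countAbove f.roots t ≤ countAbove g.roots t + 1) : InterlacedBy f g := by
  have := interlacedBy_of_countAbove (f := g) (g := -f) hg hf.neg (by
    rw [leadingCoeff_neg]; linarith) (by simpa using h₁) (by simpa using h₂)
  simpa using this.rotate.neg_neg

/-! ### Phases of real-rooted polynomials in the upper half-plane -/

open Complex in
theorem splits_of_forall_im_pos {p : ℝ[X]} (h : ∀ z : ℂ, 0 < z.im → aeval z p = 0 → p = 0) :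
    p.Splits := by
  rcases eq_or_ne p 0 with rfl | hp
  · exact .zero
  refine Splits.of_splits_map (algebraMap ℝ ℂ) (IsAlgClosed.splits _) fun z hz => ?_
  have hpz : aeval z p = 0 := by
    rw [mem_roots', IsRoot.def, eval_map_algebraMap] at hz
    exact hz.2
  have him : z.im = 0 := by
    rcases lt_trichotomy z.im 0 with h0 | h0 | h0
    · refine absurd (h (starRingEnd ℂ z) (by simpa using h0) ?_) hp
      rw [aeval_conj, hpz, map_zero]
    · exact h0
    · exact absurd (h z h0 hpz) hp
  exact ⟨z.re, Complex.ext (by simp) (by simp [him])⟩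

theorem Complex.arg_mem_Ioo_of_im_pos {z : ℂ} (hz : 0 < z.im) :
    0 < z.arg ∧ z.arg < Real.pi := by
  refine ⟨lt_of_le_of_ne (Complex.arg_nonneg_iff.2 hz.le) fun h => ?_,
    lt_of_le_of_ne (Complex.arg_le_pi z) fun h => ?_⟩
  · exact hz.ne' (Complex.arg_eq_zero_iff.1 h.symm).2
  · exact hz.ne' (Complex.arg_eq_pi_iff.1 h).2

/-- `arg (z - a)`, summed over the elements `a` of `s`. -/
noncomputable def argSum (s : Multiset ℝ) (z : ℂ) : ℝ := (s.map fun a : ℝ => (z - a).arg).sum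

theorem exists_prod_sub_eq (s : Multiset ℝ) {z : ℂ} (hz : 0 < z.im) :
    ∃ r : ℝ, 0 < r ∧ (s.map fun a : ℝ => z - a).prod = r * Complex.exp (argSum s z * Complex.I) := by
  induction s using Multiset.induction with
  | empty => exact ⟨1, one_pos, by simp [argSum]⟩
  | cons a s ih =>
    obtain ⟨r, hr, h⟩ := ih
    have hza : z - a ≠ 0 := fun h0 => hz.ne' (by simpa using congrArg Complex.im h0)
    refine ⟨‖z - a‖ * r, mul_pos (norm_pos_iff.2 hza) hr, ?_⟩
    have : argSum (a ::ₘ s) z = (z - a).arg + argSum s z := by simp [argSum]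
    rw [Multiset.map_cons, Multiset.prod_cons, h, this]
    nth_rewrite 1 [← Complex.norm_mul_exp_arg_mul_I (z - a)]
    push_cast
    rw [add_mul, Complex.exp_add]
    ring

/-- `0` or `1`, according to whether the leading coefficient is positive or not. -/
noncomputable def signShift (p : ℝ[X]) : ℤ := if 0 < p.leadingCoeff then 0 else 1

/-- A continuous choice of the argument of `p z` for real-rooted `p` and `z` in the upper
half-plane. -/
noncomputable def phase (p : ℝ[X]) (z : ℂ) : ℝ := argSum p.roots z + Real.pi * signShift p

theorem exists_aeval_eq_exp_phase {p : ℝ[X]} (hp : p.Splits) (hp0 : p ≠ 0) {z : ℂ}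
    (hz : 0 < z.im) :
    ∃ r : ℝ, 0 < r ∧ aeval z p = r * Complex.exp (phase p z * Complex.I) := by
  obtain ⟨r, hr, h⟩ := exists_prod_sub_eq p.roots hz
  have hlc : p.leadingCoeff ≠ 0 := leadingCoeff_ne_zero.2 hp0
  refine ⟨|p.leadingCoeff| * r, mul_pos (abs_pos.2 hlc) hr, ?_⟩
  have h1 : aeval z p = p.leadingCoeff * (p.roots.map fun a : ℝ => z - a).prod := by
    nth_rewrite 1 [hp.eq_prod_roots]
    rw [map_mul, aeval_C, map_multiset_prod, Multiset.map_map]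
    simp
  rw [h1, h, phase]
  rcases lt_or_gt_of_ne hlc with h0 | h0
  · rw [abs_of_neg h0, signShift, if_neg h0.not_gt]
    push_cast
    rw [add_mul, Complex.exp_add, mul_one, Complex.exp_pi_mul_I]
    ring
  · rw [abs_of_pos h0, signShift, if_pos h0]
    push_cast
    rw [mul_zero, add_zero]
    ring

theorem continuousOn_phase (p : ℝ[X]) : ContinuousOn (phase p) {z | 0 < z.im} := by
  unfold phase
  refine ContinuousOn.add ?_ continuousOn_const
  generalize p.roots = s
  induction s using Multiset.induction with
  | empty => exact continuousOn_const.congr fun z _ => show argSum 0 z = 0 by simp [argSum]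
  | cons a s ih =>
    have : argSum (a ::ₘ s) = fun z : ℂ => (z - a).arg + argSum s z := by ext; simp [argSum]
    rw [this]
    refine ContinuousOn.add (fun z hz => ContinuousAt.continuousWithinAt ?_) ih
    refine ContinuousAt.comp (g := Complex.arg) (f := fun z : ℂ => z - a)
      (Complex.continuousAt_arg ?_) (by fun_prop)
    right
    simpa using (show 0 < z.im from hz).ne'

-- Approaching `t` from above, `arg (z - a)` tends to `π` if `a > t` and to `0` if `a < t`.
open Filter Topology in
theorem tendsto_phase (p : ℝ[X]) {t : ℝ} (ht : t ∉ p.roots) :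
    Tendsto (fun y : ℝ => phase p (t + y * Complex.I)) (𝓝[>] 0)
      (𝓝 (Real.pi * ((countAbove p.roots t : ℤ) + signShift p : ℤ))) := by
  unfold phase
  push_cast
  rw [mul_add]
  refine Tendsto.add ?_ tendsto_const_nhds
  generalize p.roots = s at ht
  induction s using Multiset.induction with
  | empty => simp [argSum, countAbove]
  | cons a s ih =>
    rw [Multiset.mem_cons, not_or] at ht
    have h1 : ∀ z, argSum (a ::ₘ s) z = argSum s z + (z - a).arg := fun z => by
      simp [argSum, add_comm]
    have h2 : Real.pi * (countAbove (a ::ₘ s) t : ℝ) =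
        Real.pi * countAbove s t + if t < a then Real.pi else 0 := by
      rw [countAbove, Multiset.countP_cons]
      split_ifs <;> push_cast <;> simp [countAbove, mul_add]
    rw [h2]
    simp only [h1]
    refine (ih ht.2).add ?_
    have hc : Tendsto (fun y : ℝ => (t + y * Complex.I - a : ℂ)) (𝓝[>] 0) (𝓝 ((t - a : ℝ) : ℂ)) := by
      have : Continuous (fun y : ℝ => (t + y * Complex.I - a : ℂ)) := by fun_prop
      have := this.tendsto 0
      simp only [Complex.ofReal_zero, zero_mul, add_zero] at this
      push_cast
      exact this.mono_left nhdsWithin_le_nhds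
    rcases lt_or_gt_of_ne ht.1 with h0 | h0
    · rw [if_pos h0]
      refine (Complex.tendsto_arg_nhdsWithin_im_nonneg_of_re_neg_of_im_zero (z := ((t - a : ℝ) : ℂ))
        (by simpa using h0) (by simp)).comp (tendsto_nhdsWithin_iff.2 ⟨hc, ?_⟩)
      filter_upwards [self_mem_nhdsWithin] with y hy
      simpa using (show (0:ℝ) < y from hy).le
    · have h3 := ((Complex.continuousAt_arg (Or.inl (by simpa using h0))).tendsto).comp hc
      rw [Complex.arg_ofReal_of_nonneg (sub_nonneg.2 h0.le)] at h3
      rwa [if_neg (not_lt.2 h0.le)]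

/-! ### Interlacing as an inequality on the upper half-plane -/

theorem im_mul_conj_exp (r s a b : ℝ) :
    ((r * Complex.exp (a * Complex.I)) * (starRingEnd ℂ) (s * Complex.exp (b * Complex.I))).im =
      r * s * Real.sin (a - b) := by
  rw [Real.sin_sub]
  simp [Complex.exp_mul_I, ← Complex.ofReal_cos, ← Complex.ofReal_sin]
  ring

theorem arg_sub_lt_arg_sub {z : ℂ} (hz : 0 < z.im) {a b : ℝ} (hab : a < b) :
    (z - a).arg < (z - b).arg := by
  have ha := Complex.arg_mem_Ioo_of_im_pos (z := z - a) (by simpa using hz)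
  have hb := Complex.arg_mem_Ioo_of_im_pos (z := z - b) (by simpa using hz)
  by_contra! h
  have h1 := im_mul_conj_exp ‖z - a‖ ‖z - b‖ (z - a).arg (z - b).arg
  rw [Complex.norm_mul_exp_arg_mul_I, Complex.norm_mul_exp_arg_mul_I] at h1
  have h2 : 0 ≤ Real.sin ((z - a).arg - (z - b).arg) :=
    Real.sin_nonneg_of_nonneg_of_le_pi (by linarith) (by linarith)
  have h3 : 0 ≤ ‖z - a‖ * ‖z - b‖ * Real.sin ((z - a).arg - (z - b).arg) := by positivity
  rw [← h1] at h3
  -- The imaginary part of `(z - a) * conj (z - b)` is `z.im * (a - b)`, which is negative.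
  simp at h3
  nlinarith

/-- Each argument is positive and strictly increasing in the root, so moving roots to the right or
adding roots increases the sum. -/
theorem argSum_lt_or_eq {z : ℂ} (hz : 0 < z.im) (A B : List ℝ) (hlen : A.length ≤ B.length)
    (h : ∀ (i : ℕ) (hA : i < A.length) (hB : i < B.length), A[i] ≤ B[i]) :
    argSum A z < argSum B z ∨ A = B := by
  have hcons : ∀ (a : ℝ) (L : List ℝ), argSum ((a :: L : List ℝ) : Multiset ℝ) z =
      (z - a).arg + argSum L z := fun a L => by simp [argSum]
  induction A generalizing B with
  | nil =>
    induction B with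
    | nil => exact .inr rfl
    | cons b B ih =>
      left
      rw [hcons]
      have hb := (Complex.arg_mem_Ioo_of_im_pos (z := z - b) (by simpa using hz)).1
      rcases ih (by simp) (by simp) with h | h
      · linarith
      · rw [← h]; linarith
  | cons a A ih =>
    cases B with
    | nil => simp at hlen
    | cons b B =>
      have hab : a ≤ b := h 0 (by simp) (by simp)
      rw [hcons, hcons]
      rcases ih B (by simpa using hlen)
        (fun i hA hB => h (i + 1) (by simpa using hA) (by simpa using hB)) with h1 | rfl
      · left
        rcases hab.lt_or_eq with h2 | rfl
        · linarith [arg_sub_lt_arg_sub hz h2]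
        · linarith
      · rcases hab.lt_or_eq with h2 | rfl
        · left
          linarith [arg_sub_lt_arg_sub hz h2]
        · exact .inr rfl

theorem argSum_rootList (p : ℝ[X]) (z : ℂ) : argSum (rootList p) z = argSum p.roots z := by
  rw [rootList, Multiset.sort_eq]

/-- The largest entry of `B` contributes less than `π`; the remaining ones are dominated by the
entries of `A`. -/
theorem argSum_lt_add_pi {z : ℂ} (hz : 0 < z.im) (A B : List ℝ) (hlen : B.length ≤ A.length + 1)
    (h : ∀ (i : ℕ) (hA : i < A.length) (hB : i + 1 < B.length), B[i + 1] ≤ A[i]) :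
    argSum B z < argSum A z + Real.pi := by
  cases B with
  | nil =>
    rcases argSum_lt_or_eq hz [] A (by simp) (by simp) with h | h
    · linarith [Real.pi_pos]
    · rw [h]; linarith [Real.pi_pos]
  | cons b B =>
    have : argSum ((b :: B : List ℝ) : Multiset ℝ) z = (z - b).arg + argSum B z := by
      simp [argSum]
    have hb := (Complex.arg_mem_Ioo_of_im_pos (z := z - b) (by simpa using hz)).2
    rcases argSum_lt_or_eq hz B A (by simpa using hlen)
      (fun i hB hA => h i hA (by simpa using hB)) with h | h
    · linarith
    · rw [this, h]; linarith

-- For positive leading coefficients the phase difference lies strictly between `-π` and `0`, unless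
-- the roots coincide. The conclusion is invariant under `(f, g) ↦ (g, -f)`, so the induction covers
-- all signs.
open ComplexConjugate in
theorem InterlacedBy.dependent_or_im_neg {f g : ℝ[X]} (h : InterlacedBy f g) :
    f.Splits ∧ g.Splits ∧ ((∃ a b : ℝ, (a ≠ 0 ∨ b ≠ 0) ∧ a • f + b • g = 0) ∨
      ∀ z : ℂ, 0 < z.im → (aeval z f * conj (aeval z g)).im < 0) := by
  induction h with
  | of_pos f g hf hg hf0 hg0 hdeg halt =>
    refine ⟨hf, hg, or_iff_not_imp_left.2 fun hdep z hz => ?_⟩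
    have hf' : f ≠ 0 := leadingCoeff_ne_zero.1 hf0.ne'
    have hg' : g ≠ 0 := leadingCoeff_ne_zero.1 hg0.ne'
    have hlf : (rootList f).length = f.natDegree := by
      rw [rootList, Multiset.length_sort, hf.natDegree_eq_card_roots]
    have hlg : (rootList g).length = g.natDegree := by
      rw [rootList, Multiset.length_sort, hg.natDegree_eq_card_roots]
    have h1 := argSum_lt_or_eq hz (rootList f) (rootList g) (by omega) halt.1
    have h2 := argSum_lt_add_pi hz (rootList f) (rootList g) (by omega) halt.2
    have h1 : argSum (rootList f) z < argSum (rootList g) z := by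
      refine h1.resolve_right fun h => hdep ⟨g.leadingCoeff, -f.leadingCoeff, .inl hg0.ne', ?_⟩
      have hr : f.roots = g.roots := by
        rw [← f.roots.sort_eq (· ≥ ·), ← g.roots.sort_eq (· ≥ ·)]
        exact congrArg _ h
      have h3 := hf.eq_prod_roots
      have h4 := hg.eq_prod_roots
      rw [hr] at h3
      rw [smul_eq_C_mul, smul_eq_C_mul, C_neg]
      linear_combination C g.leadingCoeff * h3 - C f.leadingCoeff * h4
    rw [argSum_rootList, argSum_rootList] at h1 h2
    obtain ⟨r, hr, h3⟩ := exists_aeval_eq_exp_phase hf hf' hz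
    obtain ⟨s, hs, h4⟩ := exists_aeval_eq_exp_phase hg hg' hz
    have h5 : Real.sin (phase f z - phase g z) < 0 := by
      refine Real.sin_neg_of_neg_of_neg_pi_lt ?_ ?_ <;>
      · simp only [phase, signShift, hf0, hg0, if_true, Int.cast_zero, mul_zero, add_zero]
        linarith
    rw [h3, h4, im_mul_conj_exp]
    exact mul_neg_of_pos_of_neg (mul_pos hr hs) h5
  | rotate f g _ ih =>
    obtain ⟨hf, hg, ih⟩ := ih
    refine ⟨hg, hf.neg, ih.imp ?_ fun ih z hz => ?_⟩
    · rintro ⟨a, b, hab, h⟩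
      exact ⟨b, -a, by simpa [or_comm] using hab, by rw [neg_smul_neg, add_comm, h]⟩
    · have := ih z hz
      simp only [map_neg, Complex.mul_im, Complex.neg_re, Complex.neg_im, Complex.conj_re,
        Complex.conj_im] at this ⊢
      linarith
  | zero_left f hf => exact ⟨.zero, hf, .inl ⟨1, 0, by simp⟩⟩
  | zero_right f hf => exact ⟨hf, .zero, .inl ⟨0, 1, by simp⟩⟩

/-! ### Real-rootedness of linear combinations -/

theorem splits_smul {p : ℝ[X]} (hp : p.Splits) (c : ℝ) : (c • p).Splits := by
  rw [smul_eq_C_mul]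
  exact hp.C_mul c

theorem InterlacedBy.splits_add {f g : ℝ[X]} (h : InterlacedBy f g) (x y : ℝ) :
    (x • f + y • g).Splits := by
  obtain ⟨hf, hg, ⟨a, b, hab, h⟩ | h⟩ := h.dependent_or_im_neg
  · rcases hab with ha | hb
    · have : f = (-(b / a)) • g := by
        have : f = a⁻¹ • (a • f) := by rw [smul_smul, inv_mul_cancel₀ ha, one_smul]
        rw [this, eq_neg_of_add_eq_zero_left h]
        module
      rw [this, smul_smul, ← add_smul]
      exact splits_smul hg _
    · have : g = (-(a / b)) • f := by
        have : g = b⁻¹ • (b • g) := by rw [smul_smul, inv_mul_cancel₀ hb, one_smul]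
        rw [this, eq_neg_of_add_eq_zero_right h]
        module
      rw [this, smul_smul, ← add_smul]
      exact splits_smul hf _
  · refine splits_of_forall_im_pos fun z hz h0 => ?_
    have h1 := h z hz
    have h2 : x * (aeval z f * (starRingEnd ℂ) (aeval z g)).im = 0 := by
      have := congrArg (fun w => (w * (starRingEnd ℂ) (aeval z g)).im) h0
      simp [Complex.mul_im] at this
      simp only [Complex.mul_im, Complex.conj_re, Complex.conj_im]
      linear_combination this
    have hx : x = 0 := (mul_eq_zero.1 h2).resolve_right h1.ne
    -- Independence gives a strict inequality, so both coefficients must vanish.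
    subst hx
    have hgz : aeval z g ≠ 0 := fun h' => by simp [h'] at h1
    have hy : y = 0 := by
      simpa [hgz] using h0
    simp [hy]

theorem splits_sum_of_interlacedBy {ι : Type*} (s : Finset ι) (f : ι → ℝ[X]) {g : ℝ[X]}
    (hg0 : g ≠ 0) (hfg : ∀ i, InterlacedBy (f i) g) (c : ι → ℝ) (hc : ∀ i, 0 ≤ c i) :
    (∑ i ∈ s, c i • f i).Splits := by
  classical
  have key : ∀ i, (∃ d : ℝ, c i • f i = d • g) ∨ ∀ z : ℂ, 0 < z.im →
      (aeval z (c i • f i) * (starRingEnd ℂ) (aeval z g)).im < 0 := by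
    intro i
    obtain ⟨hf, hg, ⟨a, b, hab, h⟩ | h⟩ := (hfg i).dependent_or_im_neg
    · left
      -- Here `g ≠ 0` is essential: every real-rooted polynomial satisfies `f ≪ 0`.
      have ha : a ≠ 0 := by
        rintro rfl
        simp [hg0] at h hab
        exact hab h
      refine ⟨-(c i * b / a), ?_⟩
      have : f i = a⁻¹ • (a • f i) := by rw [smul_smul, inv_mul_cancel₀ ha, one_smul]
      rw [this, eq_neg_of_add_eq_zero_left h]
      module
    · rcases (hc i).eq_or_lt with h0 | h0
      · exact .inl ⟨0, by simp [← h0]⟩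
      · right
        intro z hz
        have := mul_neg_of_pos_of_neg h0 (h z hz)
        simp [Complex.mul_im] at this ⊢
        linarith
  have hg := (show ∀ i, g.Splits from fun i => (hfg i).dependent_or_im_neg.2.1)
  have main : (∃ d : ℝ, ∑ i ∈ s, c i • f i = d • g) ∨ ∀ z : ℂ, 0 < z.im →
      (aeval z (∑ i ∈ s, c i • f i) * (starRingEnd ℂ) (aeval z g)).im < 0 := by
    have himg : ∀ (d : ℝ) (z : ℂ), (aeval z (d • g) * (starRingEnd ℂ) (aeval z g)).im = 0 := by
      intro d z
      simp [Complex.mul_im]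
      ring
    generalize hF : (fun i => c i • f i) = F at key ⊢
    simp only [funext_iff] at hF
    simp only [hF] at key ⊢
    clear hF
    induction s using Finset.induction with
    | empty => exact .inl ⟨0, by simp⟩
    | insert i s hi ih =>
      simp only [Finset.sum_insert hi, map_add, add_mul, Complex.add_im]
      rcases key i with ⟨d, hd⟩ | h1 <;> rcases ih with ⟨e, he⟩ | h2
      · exact .inl ⟨d + e, by rw [hd, he, add_smul]⟩
      · right
        intro z hz
        rw [hd, himg, zero_add]
        exact h2 z hz
      · right
        intro z hz
        rw [he, himg, add_zero]
        exact h1 z hz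
      · exact .inr fun z hz => add_neg (h1 z hz) (h2 z hz)
  rcases s.eq_empty_or_nonempty with rfl | ⟨i, _⟩
  · simp
  rcases main with ⟨d, hd⟩ | h
  · rw [hd]
    exact splits_smul (hg i) d
  · exact splits_of_forall_im_pos fun z hz h0 => by simpa [h0] using h z hz

/-! ### From phase differences back to interlacing -/

/-- By the intermediate value theorem, a continuous function that avoids an arithmetic progression
stays in one of its gaps. -/
theorem IsPreconnected.exists_int_between {X : Type*} [TopologicalSpace X] {S : Set X}
    (hS : IsPreconnected S) {h : X → ℝ} (hh : ContinuousOn h S) {p c : ℝ} (hp : 0 < p)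
    (hne : ∀ z ∈ S, ∀ n : ℤ, h z ≠ c + p * n) :
    ∃ k : ℤ, ∀ z ∈ S, c + p * k < h z ∧ h z < c + p * (k + 1) := by
  rcases S.eq_empty_or_nonempty with rfl | ⟨w, hw⟩
  · exact ⟨0, by simp⟩
  refine ⟨⌊(h w - c) / p⌋, fun z hz => ?_⟩
  set k := ⌊(h w - c) / p⌋ with hk
  have h1 : c + p * k ≤ h w := by
    have := Int.floor_le ((h w - c) / p)
    rw [← hk, le_div_iff₀ hp] at this
    linarith
  have h2 : h w < c + p * (k + 1) := by
    have := Int.lt_floor_add_one ((h w - c) / p)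
    rw [← hk, div_lt_iff₀ hp] at this
    linarith
  constructor
  · by_contra! hlt
    obtain ⟨u, hu, hu'⟩ := hS.intermediate_value hz hw hh ⟨hlt, h1⟩
    exact hne u hu k hu'
  · by_contra! hlt
    obtain ⟨u, hu, hu'⟩ := hS.intermediate_value hw hz hh ⟨h2.le, hlt⟩
    exact hne u hu (k + 1) (by rw [hu']; push_cast; ring)

theorem isPreconnected_im_pos : IsPreconnected {z : ℂ | 0 < z.im} :=
  (convex_halfSpace_im_gt 0).isPreconnected

/-- A bound for the difference of two phases in the upper half-plane passes to the real line. -/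
theorem countAbove_sub_le_of_phase_sub_le {p q : ℝ[X]} {n : ℤ}
    (h : ∀ z : ℂ, 0 < z.im → phase p z - phase q z ≤ Real.pi * n) (t : ℝ) :
    (countAbove p.roots t + signShift p : ℤ) - (countAbove q.roots t + signShift q) ≤ n := by
  obtain ⟨u, hu, hcount⟩ := exists_gt_countAbove_eq (p.roots + q.roots) t
  rw [Multiset.mem_add, not_or] at hu
  rw [← hcount _ (Multiset.le_add_right _ _), ← hcount _ (Multiset.le_add_left _ _)]
  have h1 := le_of_tendsto ((tendsto_phase p hu.1).sub (tendsto_phase q hu.2)) (b := Real.pi * n) (by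
    filter_upwards [self_mem_nhdsWithin] with y hy
    exact h _ (by simpa using hy))
  rw [← mul_sub, mul_le_mul_iff_right₀ Real.pi_pos] at h1
  exact_mod_cast h1

theorem Polynomial.Splits.aeval_ne_zero_of_im_pos {p : ℝ[X]} (hp : p.Splits) (hp0 : p ≠ 0) {z : ℂ}
    (hz : 0 < z.im) : aeval z p ≠ 0 := by
  obtain ⟨r, hr, h⟩ := exists_aeval_eq_exp_phase hp hp0 hz
  rw [h]
  exact mul_ne_zero (Complex.ofReal_ne_zero.2 hr.ne') (Complex.exp_ne_zero _)

theorem signShift_eq_iff {p q : ℝ[X]} (hp : p ≠ 0) (hq : q ≠ 0) :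
    (signShift p = signShift q ∧ 0 < p.leadingCoeff * q.leadingCoeff) ∨
      ((signShift p = signShift q + 1 ∨ signShift q = signShift p + 1) ∧
        p.leadingCoeff * q.leadingCoeff < 0) := by
  rcases lt_or_gt_of_ne (leadingCoeff_ne_zero.2 hp) with h1 | h1 <;>
  rcases lt_or_gt_of_ne (leadingCoeff_ne_zero.2 hq) with h2 | h2
  · simp [signShift, h1.not_gt, h2.not_gt, mul_pos_of_neg_of_neg h1 h2]
  · simp [signShift, h1.not_gt, h2, mul_neg_of_neg_of_pos h1 h2]
  · simp [signShift, h1, h2.not_gt, mul_neg_of_pos_of_neg h1 h2]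
  · simp [signShift, h1, h2, mul_pos h1 h2]

theorem interlacedBy_smul {p : ℝ[X]} (hp : p.Splits) (c : ℝ) : InterlacedBy (c • p) p := by
  rcases eq_or_ne p 0 with rfl | hp0
  · simpa using InterlacedBy.zero_left 0 hp
  rcases lt_trichotomy c 0 with hc | rfl | hc
  · refine interlacedBy_of_countAbove_of_neg (splits_smul hp c) hp ?_ (fun t => ?_) (fun t => ?_)
    · have := leadingCoeff_ne_zero.2 hp0
      rw [smul_eq_C_mul, leadingCoeff_mul, leadingCoeff_C, mul_assoc]
      exact mul_neg_of_neg_of_pos hc (mul_self_pos.2 this)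
    · rw [roots_smul_nonzero _ hc.ne]
    · rw [roots_smul_nonzero _ hc.ne]
      omega
  · simpa using InterlacedBy.zero_left p hp
  · refine interlacedBy_of_countAbove (splits_smul hp c) hp ?_ (fun t => ?_) (fun t => ?_)
    · have := leadingCoeff_ne_zero.2 hp0
      rw [smul_eq_C_mul, leadingCoeff_mul, leadingCoeff_C, mul_assoc]
      exact mul_pos hc (mul_self_pos.2 this)
    · rw [roots_smul_nonzero _ hc.ne']
    · rw [roots_smul_nonzero _ hc.ne']
      omega

/-- If all real linear combinations of `f` and `g` are real-rooted, then one of them interlaces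
the other. -/
theorem interlacedBy_or_of_forall_splits {f g : ℝ[X]}
    (h : ∀ x y : ℝ, (x • f + y • g).Splits) : InterlacedBy f g ∨ InterlacedBy g f := by
  have hf : f.Splits := by simpa using h 1 0
  have hg : g.Splits := by simpa using h 0 1
  rcases eq_or_ne g 0 with rfl | hg0
  · exact .inl (.zero_right f hf)
  by_cases hdep : ∃ c : ℝ, f = c • g
  · obtain ⟨c, rfl⟩ := hdep
    exact .inl (interlacedBy_smul hg c)
  have hf0 : f ≠ 0 := by
    rintro rfl
    exact hdep ⟨0, by simp⟩
  obtain ⟨k, hk⟩ := isPreconnected_im_pos.exists_int_between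
    ((continuousOn_phase f).sub (continuousOn_phase g)) (c := 0) Real.pi_pos (by
      -- If the difference is a multiple of `π`, then `f(z) * conj (g(z))` is a real number `y`, so
      -- `|g(z)|² • f - y • g` vanishes at `z`. Being real-rooted it is zero, against independence.
      intro z hz n hn
      rw [zero_add, Pi.sub_apply] at hn
      have hgz := hg.aeval_ne_zero_of_im_pos hg0 hz
      obtain ⟨r, hr, h1⟩ := exists_aeval_eq_exp_phase hf hf0 hz
      obtain ⟨s, hs, h2⟩ := exists_aeval_eq_exp_phase hg hg0 hz
      have him : (aeval z f * (starRingEnd ℂ) (aeval z g)).im = 0 := by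
        rw [h1, h2, im_mul_conj_exp, hn, mul_comm Real.pi, Real.sin_int_mul_pi, mul_zero]
      set x := Complex.normSq (aeval z g) with hx
      set y := (aeval z f * (starRingEnd ℂ) (aeval z g)).re with hy
      have hx0 : x ≠ 0 := Complex.normSq_eq_zero.not.2 hgz
      have hxy : x • f + (-y) • g = 0 := by
        by_contra hne
        refine (h x (-y)).aeval_ne_zero_of_im_pos hne hz ?_
        have h3 : aeval z f * (starRingEnd ℂ) (aeval z g) = (y : ℂ) :=
          Complex.ext (by simp [hy]) (by rw [him]; simp)
        simp only [map_add, map_smul, Complex.real_smul, Complex.ofReal_neg]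
        rw [hx, ← Complex.mul_conj, ← h3]
        ring
      refine hdep ⟨y / x, ?_⟩
      have : f = x⁻¹ • (x • f) := by rw [smul_smul, inv_mul_cancel₀ hx0, one_smul]
      rw [this, eq_neg_of_add_eq_zero_left hxy]
      module)
  simp only [Pi.sub_apply, zero_add] at hk
  have h1 := countAbove_sub_le_of_phase_sub_le (p := f) (q := g) (n := k + 1) fun z hz => by
    push_cast
    exact (hk z hz).2.le
  have h2 := countAbove_sub_le_of_phase_sub_le (p := g) (q := f) (n := -k) fun z hz => by
    push_cast
    linarith [(hk z hz).1]
  obtain ⟨t₀, ht₀⟩ := exists_forall_gt (f.roots + g.roots)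
  have h1' := h1 t₀
  have h2' := h2 t₀
  rw [countAbove_eq_zero fun a ha => ht₀ a (Multiset.mem_add.2 (.inl ha)),
    countAbove_eq_zero fun a ha => ht₀ a (Multiset.mem_add.2 (.inr ha))] at h1' h2'
  -- To the right of all roots both counts vanish, so the two bounds restrict `k` to two values, one
  -- for each direction of interlacing of the roots.
  obtain hK | hK : k + signShift g - signShift f = 0 ∨ k + signShift g - signShift f = -1 := by
    omega
  · have h3 : ∀ t, countAbove g.roots t ≤ countAbove f.roots t := fun t => by
      have := h2 t
      omega
    have h4 : ∀ t, countAbove f.roots t ≤ countAbove g.roots t + 1 := fun t => by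
      have := h1 t
      omega
    rcases signShift_eq_iff hf0 hg0 with ⟨-, h0⟩ | ⟨-, h0⟩
    · exact .inr (interlacedBy_of_countAbove hg hf (by linarith) h3 h4)
    · exact .inl (interlacedBy_of_countAbove_of_neg hf hg h0 h3 h4)
  · have h3 : ∀ t, countAbove f.roots t ≤ countAbove g.roots t := fun t => by
      have := h1 t
      omega
    have h4 : ∀ t, countAbove g.roots t ≤ countAbove f.roots t + 1 := fun t => by
      have := h2 t
      omega
    rcases signShift_eq_iff hf0 hg0 with ⟨-, h0⟩ | ⟨-, h0⟩
    · exact .inl (interlacedBy_of_countAbove hf hg h0 h3 h4)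
    · exact .inr (interlacedBy_of_countAbove_of_neg hg hf (by linarith) h3 h4)

/-! ### Construction of a common interlacer -/

/-- Cramer's rule for three unit vectors in the plane; it supplies the coefficients of a positive
relation. -/
theorem sin_mul_exp_add_eq_zero (a b c : ℝ) :
    (Real.sin (c - b) : ℂ) * Complex.exp (a * Complex.I) +
      (Real.sin (a - c) : ℂ) * Complex.exp (b * Complex.I) +
      (Real.sin (b - a) : ℂ) * Complex.exp (c * Complex.I) = 0 := by
  simp only [Complex.exp_mul_I, Real.sin_sub]
  push_cast
  ring

/-- The polynomials `f i` have no non-trivial non-negative relation of length at most three at any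
point of the upper half-plane. -/
def NoPositiveRelation {ι : Type*} (f : ι → ℝ[X]) : Prop :=
  ∀ z : ℂ, 0 < z.im → ∀ (i j k : ι) (a b c : ℝ), 0 ≤ a → 0 ≤ b → 0 ≤ c →
    a * aeval z (f i) + b * aeval z (f j) + c * aeval z (f k) = 0 → a = 0

/-- Values on opposite rays are excluded, so each phase relative to a reference `f o` stays in a
fixed interval of length `2π` around `2π * k i`. A further violation would make three values
surround the origin. -/
theorem NoPositiveRelation.exists_phase_shift {ι : Type*} [Nonempty ι] {f : ι → ℝ[X]}
    (H : NoPositiveRelation f) (hs : ∀ i, (f i).Splits) (h0 : ∀ i, f i ≠ 0) :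
    ∃ k : ι → ℤ, ∀ i j, ∀ z : ℂ, 0 < z.im →
      phase (f i) z - phase (f j) z ≤ 2 * Real.pi * (k i - k j) + Real.pi := by
  obtain ⟨o⟩ := ‹Nonempty ι›
  have hk : ∀ i, ∃ k : ℤ, ∀ z ∈ {z : ℂ | 0 < z.im},
      -Real.pi + 2 * Real.pi * k < (phase (f i) - phase (f o)) z ∧
        (phase (f i) - phase (f o)) z < -Real.pi + 2 * Real.pi * (k + 1) := by
    intro i
    refine isPreconnected_im_pos.exists_int_between
      ((continuousOn_phase _).sub (continuousOn_phase _)) Real.two_pi_pos fun z hz n hn => ?_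
    rw [Pi.sub_apply] at hn
    obtain ⟨r, hr, h1⟩ := exists_aeval_eq_exp_phase (hs i) (h0 i) hz
    obtain ⟨s, hs, h2⟩ := exists_aeval_eq_exp_phase (hs o) (h0 o) hz
    refine hs.ne' (H z hz i o o s r 0 hs.le hr.le le_rfl ?_)
    have h3 : Complex.exp (phase (f i) z * Complex.I) =
        -Complex.exp (phase (f o) z * Complex.I) := by
      have : (phase (f i) z : ℂ) * Complex.I = phase (f o) z * Complex.I +
          n * (2 * Real.pi * Complex.I) - Real.pi * Complex.I := by
        rw [show phase (f i) z = phase (f o) z + (-Real.pi + 2 * Real.pi * n) by linarith]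
        push_cast
        ring
      rw [this, Complex.exp_sub, Complex.exp_add, Complex.exp_int_mul_two_pi_mul_I,
        Complex.exp_pi_mul_I]
      ring
    rw [h1, h2, h3]
    push_cast
    ring
  choose k hk using hk
  refine ⟨k, fun i j z hz => ?_⟩
  by_contra! hlt
  obtain ⟨hi1, hi2⟩ := hk i z hz
  obtain ⟨hj1, hj2⟩ := hk j z hz
  rw [Pi.sub_apply] at hi1 hi2 hj1 hj2
  obtain ⟨r, hr, h1⟩ := exists_aeval_eq_exp_phase (hs i) (h0 i) hz
  obtain ⟨s, hs', h2⟩ := exists_aeval_eq_exp_phase (hs j) (h0 j) hz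
  obtain ⟨u, hu, h3⟩ := exists_aeval_eq_exp_phase (hs o) (h0 o) hz
  -- Relative to `f o`, the reduced angles of `f i` and `f j` lie in `(-π, π)` and, by `hlt`, differ
  -- by more than `π`. Hence the first is positive, the second is negative, and all three sines are
  -- positive.
  have hsin1 : 0 < Real.sin (phase (f o) z - phase (f j) z) := by
    rw [← Real.sin_add_int_mul_two_pi _ (k j)]
    exact Real.sin_pos_of_pos_of_lt_pi (by linarith) (by linarith)
  have hsin2 : 0 < Real.sin (phase (f i) z - phase (f o) z) := by
    rw [← Real.sin_sub_int_mul_two_pi _ (k i)]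
    exact Real.sin_pos_of_pos_of_lt_pi (by linarith) (by linarith)
  have hsin3 : 0 < Real.sin (phase (f j) z - phase (f i) z) := by
    rw [← Real.sin_add_int_mul_two_pi _ (k i - k j + 1)]
    refine Real.sin_pos_of_pos_of_lt_pi ?_ ?_ <;> push_cast <;> linarith
  have := H z hz i j o (Real.sin (phase (f o) z - phase (f j) z) / r)
    (Real.sin (phase (f i) z - phase (f o) z) / s) (Real.sin (phase (f j) z - phase (f i) z) / u)
    (by positivity) (by positivity) (by positivity) (by
      have hr' : (r : ℂ) ≠ 0 := Complex.ofReal_ne_zero.2 hr.ne'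
      have hs'' : (s : ℂ) ≠ 0 := Complex.ofReal_ne_zero.2 hs'.ne'
      have hu' : (u : ℂ) ≠ 0 := Complex.ofReal_ne_zero.2 hu.ne'
      rw [h1, h2, h3, ← sin_mul_exp_add_eq_zero (phase (f i) z) (phase (f j) z) (phase (f o) z),
        Complex.ofReal_div, Complex.ofReal_div, Complex.ofReal_div]
      field_simp)
  exact (div_pos hsin1 hr).ne' this

theorem NoPositiveRelation.exists_interlacedBy {ι : Type*} [Finite ι] [Nonempty ι] {f : ι → ℝ[X]}
    (H : NoPositiveRelation f) (hs : ∀ i, (f i).Splits) (h0 : ∀ i, f i ≠ 0) :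
    ∃ g : ℝ[X], g ≠ 0 ∧ g.Splits ∧ ∀ i, InterlacedBy (f i) g := by
  cases nonempty_fintype ι
  obtain ⟨k, hk⟩ := H.exists_phase_shift hs h0
  -- The phase shifted by `-2π * k i` tends to `π` times the root count plus `m i`. The parity of `m
  -- i` still records the leading sign.
  set m : ι → ℤ := fun i => signShift (f i) - 2 * k i with hm
  have hcount : ∀ i j t, (countAbove (f i).roots t : ℤ) + m i ≤ countAbove (f j).roots t + m j + 1 := by
    intro i j t
    have := countAbove_sub_le_of_phase_sub_le (p := f i) (q := f j) (n := 2 * (k i - k j) + 1)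
      (fun z hz => by
        push_cast
        linarith [hk i j z hz]) t
    simp only [hm]
    omega
  -- To the right of all roots the maximal shifted count is `m o`; subtracting it makes the maximum
  -- the counting function of a multiset `S`. Each `m i` is `m o` or `m o - 1`.
  obtain ⟨o, ho⟩ := Finite.exists_max m
  have hm1 : ∀ i, m o ≤ m i + 1 := by
    intro i
    obtain ⟨t, ht⟩ := exists_forall_gt ((f i).roots + (f o).roots)
    have := hcount o i t
    rw [countAbove_eq_zero fun a ha => ht a (Multiset.mem_add.2 (.inl ha)),
      countAbove_eq_zero fun a ha => ht a (Multiset.mem_add.2 (.inr ha))] at this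
    omega
  obtain ⟨S, hS⟩ := exists_countAbove_finset_sup Finset.univ (fun i => (f i).roots)
    (fun i => (m o - m i).toNat)
  have hlow : ∀ i t, countAbove (f i).roots t - (m o - m i).toNat ≤ countAbove S t := by
    intro i t
    rw [hS]
    exact Finset.le_sup (f := fun i => countAbove (f i).roots t - (m o - m i).toNat)
      (Finset.mem_univ i)
  have hupp : ∀ i t, countAbove S t ≤ countAbove (f i).roots t - (m o - m i).toNat + 1 ∧
      (m i < m o → countAbove S t ≤ countAbove (f i).roots t) := by
    intro i t
    rw [hS]
    constructor
    · refine Finset.sup_le fun j _ => ?_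
      have := hcount j i t
      have := ho i
      have := ho j
      omega
    · intro hi
      refine Finset.sup_le fun j _ => ?_
      have := hcount j i t
      have := hm1 i
      have := ho j
      omega
  set P : ℝ[X] := (S.map fun a => X - C a).prod with hP
  have hlc : (f o).leadingCoeff ≠ 0 := leadingCoeff_ne_zero.2 (h0 o)
  have hPs : P.Splits := Splits.multisetProd fun q hq => by
    obtain ⟨a, -, rfl⟩ := Multiset.mem_map.1 hq
    exact .X_sub_C a
  have hPm : P.Monic := monic_multiset_prod_of_monic _ _ fun a _ => monic_X_sub_C a
  have hgs : ((f o).leadingCoeff • P).Splits := splits_smul hPs _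
  have hgr : ((f o).leadingCoeff • P).roots = S := by
    rw [roots_smul_nonzero _ hlc, hP, roots_multiset_prod_X_sub_C]
  have hgl : ((f o).leadingCoeff • P).leadingCoeff = (f o).leadingCoeff := by
    rw [smul_eq_C_mul, leadingCoeff_mul, leadingCoeff_C, hPm.leadingCoeff, mul_one]
  refine ⟨(f o).leadingCoeff • P, smul_ne_zero hlc hPm.ne_zero, hgs, fun i => ?_⟩
  have h1 := hm1 i
  have h2 := ho i
  -- By parity, `m i = m o` exactly when `f i` and `f o` have the same leading sign, which is the
  -- sign given to `g`.
  rcases signShift_eq_iff (h0 i) (h0 o) with ⟨hsgn, hmul⟩ | ⟨hsgn, hmul⟩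
  · have : m i = m o := by
      simp only [hm] at *
      omega
    refine interlacedBy_of_countAbove (hs i) hgs (by rwa [hgl]) (fun t => ?_) fun t => ?_ <;> rw [hgr]
    · have := hlow i t
      omega
    · have := (hupp i t).1
      omega
  · have : m i < m o := by
      simp only [hm] at *
      omega
    refine interlacedBy_of_countAbove_of_neg (hs i) hgs (by rwa [hgl]) (fun t => ?_)
      fun t => ?_ <;> rw [hgr]
    · exact (hupp i t).2 this
    · have := hlow i t
      omega

/-! ### Compatible triples -/

theorem exists_perm_fin_three : ∀ j k : Fin 3, j ≠ k →
    ∃ σ : Equiv.Perm (Fin 3), σ 1 = j ∧ σ 2 = k := by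
  decide

theorem sum_fin_three_perm (f : Fin 3 → ℝ[X]) (c : Fin 3 → ℝ) (σ : Equiv.Perm (Fin 3)) :
    ∑ i, c i • f i = c (σ 0) • f (σ 0) + c (σ 1) • f (σ 1) + c (σ 2) • f (σ 2) := by
  rw [← Equiv.sum_comp σ, Fin.sum_univ_three]

theorem Compatible.splits_three {f : Fin 3 → ℝ[X]} (hf : Compatible f) (σ : Equiv.Perm (Fin 3))
    {x y w : ℝ} (hx : 0 ≤ x) (hy : 0 ≤ y) (hw : 0 ≤ w) :
    (x • f (σ 0) + y • f (σ 1) + w • f (σ 2)).Splits := by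
  have := hf (fun i => ![x, y, w] (σ.symm i)) (fun i => by
    generalize σ.symm i = j
    fin_cases j <;> simpa)
  rw [sum_fin_three_perm f _ σ] at this
  simpa [RealRooted] using this

/-- A compatible triple with a positive relation contains all linear combinations of two of its
members. -/
theorem Compatible.splits_add_of_relation {f : Fin 3 → ℝ[X]} (hf : Compatible f)
    (σ : Equiv.Perm (Fin 3)) {a b c : ℝ} (ha : 0 ≤ a) (hb : 0 < b) (hc : 0 ≤ c)
    (h : a • f (σ 0) + b • f (σ 1) + c • f (σ 2) = 0) (x y : ℝ) :
    (x • f (σ 0) + y • f (σ 1)).Splits := by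
  have key : ∀ x y : ℝ, 0 ≤ x → (x • f (σ 0) + y • f (σ 1)).Splits := by
    intro x y hx
    -- Adding `|y| / b` times the relation leaves the polynomial unchanged and makes the middle
    -- coefficient `y + |y| ≥ 0`.
    have hs : 0 ≤ |y| / b := by positivity
    have : x • f (σ 0) + y • f (σ 1) = (x + |y| / b * a) • f (σ 0) +
        (y + |y| / b * b) • f (σ 1) + (|y| / b * c) • f (σ 2) := by
      have h' := congrArg (fun p => (|y| / b) • p) h
      simp only [smul_add, smul_smul, smul_zero] at h'
      rw [add_smul, add_smul]
      linear_combination -h'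
    rw [this]
    refine hf.splits_three σ (by positivity) ?_ (by positivity)
    rw [div_mul_cancel₀ _ hb.ne']
    linarith [neg_abs_le y]
  rcases le_total 0 x with hx | hx
  · exact key x y hx
  · have := (key (-x) (-y) (by linarith)).neg
    rwa [neg_add, neg_smul, neg_smul, neg_neg, neg_neg] at this

/-- By compatibility, a non-negative combination vanishing at a non-real point is the zero
polynomial, so a relation at one `z` is a polynomial relation. -/
theorem Compatible.noPositiveRelation {f : Fin 3 → ℝ[X]} (hf : Compatible f)
    (hrel : ∀ c : Fin 3 → ℝ, (∀ i, 0 ≤ c i) → ∑ i, c i • f i = 0 → ∀ i, c i • f i = 0) :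
    NoPositiveRelation fun i : {i // f i ≠ 0} => f i := by
  intro z hz i j k a b c ha hb hc h
  set d : Fin 3 → ℝ := Pi.single i.1 a + Pi.single j.1 b + Pi.single k.1 c with hd
  have hsingle : ∀ (l : Fin 3) {x : ℝ}, 0 ≤ x → (0 : Fin 3 → ℝ) ≤ Pi.single l x :=
    fun l x hx => Pi.single_nonneg.2 hx
  have hd0 : ∀ l, 0 ≤ d l := fun l =>
    add_nonneg (add_nonneg (hsingle i ha l) (hsingle j hb l)) (hsingle k hc l)
  have hsum : ∑ l, d l • f l = a • f i + b • f j + c • f k := by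
    simp [hd, add_smul, Finset.sum_add_distrib, Pi.single_apply, ite_smul]
  have h0 : ∑ l, d l • f l = 0 := by
    by_contra hne
    refine (show Polynomial.Splits _ from hf d hd0).aeval_ne_zero_of_im_pos hne hz ?_
    rw [hsum]
    simpa using h
  have hdi : d i = 0 := (smul_eq_zero.1 (hrel d hd0 h0 i)).resolve_right i.2
  have hle : a ≤ d i := by
    have h1 := hsingle j hb i
    have h2 := hsingle k hc i
    simp only [Pi.zero_apply] at h1 h2
    simp only [hd, Pi.add_apply, Pi.single_eq_same]
    linarith
  linarith

theorem proposition1p3 (f : Fin 3 → ℝ[X]) (hf : ∀ i, RealRooted (f i)) :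
    Compatible f ↔
      ((∃ g : ℝ[X], g ≠ 0 ∧ RealRooted g ∧ ∀ i, InterlacedBy (f i) g) ∨
        (∃ (σ : Equiv.Perm (Fin 3)) (a b c : ℝ), 0 ≤ a ∧ 0 < b ∧ 0 < c ∧
          a • f (σ 0) + b • f (σ 1) + c • f (σ 2) = 0 ∧
          (InterlacedBy (f (σ 0)) (f (σ 1)) ∨ InterlacedBy (f (σ 1)) (f (σ 0))))) := by
  constructor
  · intro hcomp
    -- Triviality is required term by term, since a zero `f i` may carry any coefficient.
    by_cases hrel : ∀ c : Fin 3 → ℝ, (∀ i, 0 ≤ c i) → ∑ i, c i • f i = 0 → ∀ i, c i • f i = 0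
    · left
      have H := hcomp.noPositiveRelation hrel
      rcases isEmpty_or_nonempty {i // f i ≠ 0} with hE | hE
      · refine ⟨1, one_ne_zero, .one, fun i => ?_⟩
        have : f i = 0 := by
          by_contra hi
          exact hE.false ⟨i, hi⟩
        rw [this]
        exact .zero_left _ .one
      · obtain ⟨g, hg0, hg, hfg⟩ := H.exists_interlacedBy (fun i => hf i) fun i => i.2
        refine ⟨g, hg0, hg, fun i => ?_⟩
        by_cases hi : f i = 0
        · rw [hi]
          exact .zero_left _ hg
        · exact hfg ⟨i, hi⟩
    · right
      push Not at hrel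
      obtain ⟨d, hd, hsum, k, hk⟩ := hrel
      obtain ⟨j, hjk, hj⟩ : ∃ j, j ≠ k ∧ d j • f j ≠ 0 := by
        by_contra! hall
        rw [Finset.sum_eq_single_of_mem k (Finset.mem_univ k) fun j _ => hall j] at hsum
        exact hk hsum
      obtain ⟨σ, rfl, rfl⟩ := exists_perm_fin_three j k hjk
      have hpos : ∀ i, d i • f i ≠ 0 → 0 < d i := fun i hi =>
        (hd i).lt_of_ne fun h => hi (by rw [← h, zero_smul])
      rw [sum_fin_three_perm f d σ] at hsum
      exact ⟨σ, _, _, _, hd _, hpos _ hj, hpos _ hk, hsum, interlacedBy_or_of_forall_splits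
        (hcomp.splits_add_of_relation σ (hd _) (hpos _ hj) (hd _) hsum)⟩
  · rintro (⟨g, hg0, -, hfg⟩ | ⟨σ, a, b, c, -, -, hc, hrel, h⟩) d hd
    · exact splits_sum_of_interlacedBy _ f hg0 hfg d hd
    · have h2 : f (σ 2) = (-(a / c)) • f (σ 0) + (-(b / c)) • f (σ 1) := by
        have : f (σ 2) = c⁻¹ • (c • f (σ 2)) := by rw [smul_smul, inv_mul_cancel₀ hc.ne', one_smul]
        rw [this, eq_neg_of_add_eq_zero_right hrel]
        module
      have hlin : ∑ i, d i • f i = (d (σ 0) - d (σ 2) * (a / c)) • f (σ 0) +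
          (d (σ 1) - d (σ 2) * (b / c)) • f (σ 1) := by
        rw [sum_fin_three_perm f d σ, h2]
        module
      rw [hlin]
      rcases h with h | h
      · exact h.splits_add _ _
      · rw [add_comm]
        exact h.splits_add _ _
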